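/- Let $G$ be a finite simple graph of order $n=|V(G)|$ and size $m=|E(G)|$, and let $\pi(G,x)$ be its chromatic polynomial, i.e. the unique polynomial whose value at every nonnegative integer $x$ is the number of functions $f:V(G)\to\{1,\dots,x\}$ with $f(u)\neq f(v)$ for every edge $uv\in E(G)$. If $z\in\mathbb{C}$ is a root of $\pi(G,z)$, then $$|\operatorname{Im}(z)|\le \sqrt{2}\left(\binom{n}{2}-m\right)\qquad\text{and}\qquad \operatorname{Re}(z)\le n-1+\sqrt{2}\left(\binom{n}{2}-m\right).$$ -/

import Mathlib

open Polynomial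

namespace SimpleGraph

/-- The number of proper colourings of a finite graph `G` with colours `{1, …, x}` is a sum of
falling factorials of `x`, one for each partition of the vertices into independent sets. -/
theorem card_coloring_fin_eq_sum {V : Type*} [Finite V] (G : SimpleGraph V) (x : ℕ) :
    (Nat.card (G.Coloring (Fin x)) : ℤ) =
      ∑ᶠ s : {s : Setoid V // ∀ u v, s u v → ¬ G.Adj u v},
        (descPochhammer ℤ (Nat.card (Quotient s.1))).eval (x : ℤ) := by
  classical
  have : Finite (Setoid V) :=
    Finite.of_injective (fun s : Setoid V => (fun u v => s u v : V → V → Prop))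
      (fun s t h => Setoid.ext fun a b => iff_of_eq (congrFun (congrFun h a) b))
  have e : G.Coloring (Fin x) ≃
      Σ s : {s : Setoid V // ∀ u v, s u v → ¬ G.Adj u v}, (Quotient s.1 ↪ Fin x) := by
    refine Equiv.ofBijective
      (fun f => ⟨⟨Setoid.ker f, fun u v h hadj => f.valid hadj h⟩,
        ⟨Setoid.kerLift f, Setoid.kerLift_injective f⟩⟩) ⟨?_, ?_⟩
    · intro f g h
      have key : ∀ (a b : Σ s : {s : Setoid V // ∀ u v, s u v → ¬ G.Adj u v},
          (Quotient s.1 ↪ Fin x)), a = b → ∀ v : V,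
            a.2 (Quotient.mk a.1.1 v) = b.2 (Quotient.mk b.1.1 v) := by
        rintro a b rfl v
        rfl
      ext v
      exact congrArg Fin.val (key _ _ h v)
    · rintro ⟨⟨s, hs⟩, φ⟩
      let f : G.Coloring (Fin x) := Coloring.mk (fun v => φ (Quotient.mk s v))
        (fun {u v} hadj h => hs u v (Quotient.exact (φ.injective h)) hadj)
      have hker : Setoid.ker f = s := by
        ext u v
        exact ⟨fun h => Quotient.exact (φ.injective h),
          fun h => congrArg φ (Quotient.sound h)⟩
      refine ⟨f, ?_⟩
      have gen : ∀ (t : Setoid V) (ht : ∀ u v, t u v → ¬ G.Adj u v) (ψ : Quotient t ↪ Fin x),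
          t = s → (∀ v, ψ (Quotient.mk t v) = φ (Quotient.mk s v)) →
          (⟨⟨t, ht⟩, ψ⟩ : Σ s : {s : Setoid V // ∀ u v, s u v → ¬ G.Adj u v},
            (Quotient s.1 ↪ Fin x)) = ⟨⟨s, hs⟩, φ⟩ := by
        rintro t ht ψ rfl h
        have : ψ = φ := by
          ext q
          induction q using Quotient.inductionOn with
          | h v => rw [h v]
        rw [this]
      exact gen _ _ _ hker fun v => rfl
  have := Fintype.ofFinite {s : Setoid V // ∀ u v, s u v → ¬ G.Adj u v}
  rw [Nat.card_congr e, Nat.card_sigma, finsum_eq_sum_of_fintype, Nat.cast_sum]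
  refine Finset.sum_congr rfl fun s _ => ?_
  have := Fintype.ofFinite (Quotient s.1)
  rw [descPochhammer_eval_eq_descFactorial, Nat.card_eq_fintype_card, Nat.card_eq_fintype_card,
    Fintype.card_embedding_eq, Fintype.card_fin]

/-- There is exactly one polynomial whose value at every `x : ℕ` is the number of proper colourings
of the finite graph `G` with `x` colours. -/
theorem existsUnique_chromaticPolynomial {V : Type*} [Finite V] (G : SimpleGraph V) :
    ∃! p : ℤ[X], ∀ x : ℕ, p.eval (x : ℤ) = (Nat.card (G.Coloring (Fin x)) : ℤ) := by
  classical
  have : Finite (Setoid V) :=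
    Finite.of_injective (fun s : Setoid V => (fun u v => s u v : V → V → Prop))
      (fun s t h => Setoid.ext fun a b => iff_of_eq (congrFun (congrFun h a) b))
  have := Fintype.ofFinite {s : Setoid V // ∀ u v, s u v → ¬ G.Adj u v}
  refine ⟨∑ s : {s : Setoid V // ∀ u v, s u v → ¬ G.Adj u v},
    descPochhammer ℤ (Nat.card (Quotient s.1)), fun x => ?_, fun q hq => ?_⟩
  · rw [card_coloring_fin_eq_sum, finsum_eq_sum_of_fintype, eval_finsetSum]
  · refine eq_of_infinite_eval_eq _ _ (Set.Infinite.mono ?_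
      (Set.infinite_range_of_injective (Nat.cast_injective (R := ℤ))))
    rintro _ ⟨x, rfl⟩
    rw [Set.mem_ofPred_eq, hq, card_coloring_fin_eq_sum, finsum_eq_sum_of_fintype, eval_finsetSum]

/-- The chromatic polynomial of a finite graph `G`: the polynomial whose value at every
nonnegative integer `x` is the number of proper colourings of `G` with `x` colours. -/
noncomputable def chromaticPolynomial {V : Type*} [Finite V] (G : SimpleGraph V) : ℤ[X] :=
  (existsUnique_chromaticPolynomial G).choose

theorem eval_chromaticPolynomial {V : Type*} [Finite V] (G : SimpleGraph V) (x : ℕ) :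
    G.chromaticPolynomial.eval (x : ℤ) = (Nat.card (G.Coloring (Fin x)) : ℤ) :=
  (existsUnique_chromaticPolynomial G).choose_spec.1 x

end SimpleGraph

/-!
Let `E` be the set of the `k = n.choose 2 - m` edges of the complement of `G`, and write
`D j = z (z - 1) ⋯ (z - j + 1)`. The chromatic polynomial is the sum of `D (#blocks)` over the
partitions of the vertices into independent sets. Choosing a representative in each block and joining
it to the other vertices of the block encodes a partition injectively as a set `T ⊆ E` of
`n - #blocks` edges, so `π(G, z) = ∑ T ∈ A, D (n - #T)` for a family `A` of subsets of `E` that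
contains `∅` (`SimpleGraph.exists_aeval_chromaticPolynomial_eq_sum`).

Suppose that a bound fails, and let `y > √2 * k` be `|Im z|` or `Re z - (n - 1)`, respectively. Then
every factor `z - j` with `j < n` has modulus at least `y`. Let `a ≤ k` be the number of one-element
members of `A`. With `w = z - (n - 1)`, the terms with `#T ≤ 1` add up to
`D n * (w + a) / w`, and an elementary estimate gives `‖w + a‖ ≥ ‖w‖ / √2`: it comes down to
`(Re w + 2 * a) ^ 2 + (Im w) ^ 2 ≥ 2 * a ^ 2` (`norm_sq_le_two_mul_norm_add_sq`). The other terms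
have total modulus at most
`‖D n‖ * ((1 + 1 / y) ^ k - 1 - k / y) ≤ ‖D n‖ * (exp t - 1 - t) ≤ ‖D n‖ * t ^ 2` with
`t = k / y < 1 / √2`, which is less than `‖D n‖ / √2`. Hence `π(G, z) ≠ 0`.
-/

/-! ### Partitions into independent sets as sets of non-edges -/

open Classical in
/-- The edges of the stars that join the chosen representative `⟦v⟧.out` of each class of `s` to
the other elements of the class. -/
noncomputable def Setoid.starEdges {V : Type*} [Fintype V] (s : Setoid V) : Finset (Sym2 V) :=
  ({v | (Quotient.mk s v).out ≠ v} : Finset V).image fun v => s((Quotient.mk s v).out, v)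

theorem Setoid.rel_of_mk_mem_starEdges {V : Type*} [Fintype V] {s : Setoid V} {u v : V}
    (h : s(u, v) ∈ s.starEdges) : s u v := by
  classical
  simp only [Setoid.starEdges, Finset.mem_image, Finset.mem_filter, Finset.mem_univ, true_and] at h
  obtain ⟨x, -, hx⟩ := h
  have hr : s (Quotient.mk s x).out x := Quotient.mk_out x
  rcases Sym2.eq_iff.1 hx with ⟨rfl, rfl⟩ | ⟨rfl, rfl⟩
  · exact hr
  · exact s.symm hr

theorem Setoid.starEdges_injective {V : Type*} [Fintype V] :
    Function.Injective (Setoid.starEdges (V := V)) := by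
  classical
  have key : ∀ s t : Setoid V, s.starEdges = t.starEdges → s ≤ t := by
    intro s t h u v huv
    have hout : ∀ x, t (Quotient.mk s x).out x := by
      intro x
      by_cases hx : (Quotient.mk s x).out = x
      · rw [hx]
      · apply Setoid.rel_of_mk_mem_starEdges
        rw [← h]
        exact Finset.mem_image.2 ⟨x, by simpa using hx, rfl⟩
    have hq : Quotient.mk s u = Quotient.mk s v := Quotient.sound huv
    have hu := hout u
    rw [hq] at hu
    exact t.trans (t.symm hu) (hout v)
  exact fun s t h => le_antisymm (key s t h) (key t s h.symm)

theorem Setoid.card_quotient_add_card_starEdges {V : Type*} [Fintype V] (s : Setoid V) :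
    Nat.card (Quotient s) + s.starEdges.card = Fintype.card V := by
  classical
  have hinj : Set.InjOn (fun v => s((Quotient.mk s v).out, v))
      ({v | (Quotient.mk s v).out ≠ v} : Finset V) := by
    intro u hu v hv h
    rcases Sym2.eq_iff.1 h with ⟨-, h2⟩ | ⟨h1, h2⟩
    · exact h2
    · -- a representative is not a leaf of a star
      refine absurd ?_ (Finset.mem_filter.1 hv).2
      rw [← h1, Quotient.out_eq]
  have hfix : Nat.card (Quotient s) =
      ({v | (Quotient.mk s v).out = v} : Finset V).card := by
    rw [Nat.card_eq_fintype_card, ← Finset.card_univ]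
    refine Finset.card_bij (fun q _ => q.out) (fun q _ => ?_)
      (fun p _ q _ h => Quotient.out_injective h) fun v hv =>
        ⟨Quotient.mk s v, Finset.mem_univ _, (Finset.mem_filter.1 hv).2⟩
    simp [Quotient.out_eq]
  rw [Setoid.starEdges, Finset.card_image_of_injOn hinj, hfix,
    Finset.card_filter_add_card_filter_not, Finset.card_univ]

theorem Setoid.starEdges_bot {V : Type*} [Fintype V] : (⊥ : Setoid V).starEdges = ∅ := by
  classical
  refine Finset.eq_empty_of_forall_notMem fun e he => ?_
  simp only [Setoid.starEdges, Finset.mem_image, Finset.mem_filter, Finset.mem_univ, true_and] at he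
  obtain ⟨x, hx, -⟩ := he
  exact hx (Quotient.mk_out (s := (⊥ : Setoid V)) x)

namespace SimpleGraph

theorem chromaticPolynomial_eq_finsum {V : Type*} [Finite V] (G : SimpleGraph V) :
    G.chromaticPolynomial = ∑ᶠ s : {s : Setoid V // ∀ u v, s u v → ¬ G.Adj u v},
      descPochhammer ℤ (Nat.card (Quotient s.1)) := by
  have : Finite (Setoid V) :=
    Finite.of_injective (fun s : Setoid V => (fun u v => s u v : V → V → Prop))
      (fun s t h => Setoid.ext fun a b => iff_of_eq (congrFun (congrFun h a) b))
  have := Fintype.ofFinite {s : Setoid V // ∀ u v, s u v → ¬ G.Adj u v}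
  refine (existsUnique_chromaticPolynomial G).unique (eval_chromaticPolynomial G) fun x => ?_
  rw [card_coloring_fin_eq_sum, finsum_eq_sum_of_fintype, finsum_eq_sum_of_fintype,
    eval_finsetSum]

/-- The family `A` consists of the sets of star edges of the partitions of the vertices into
independent sets; `∅` comes from the partition into single vertices. -/
theorem exists_aeval_chromaticPolynomial_eq_sum {V : Type*} [Fintype V] (G : SimpleGraph V)
    [Fintype Gᶜ.edgeSet] (z : ℂ) :
    ∃ A ⊆ Gᶜ.edgeFinset.powerset, ∅ ∈ A ∧ (∀ T ∈ A, T.card ≤ Fintype.card V) ∧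
      aeval z G.chromaticPolynomial =
        ∑ T ∈ A, ∏ j ∈ Finset.range (Fintype.card V - T.card), (z - j) := by
  classical
  have : Finite (Setoid V) :=
    Finite.of_injective (fun s : Setoid V => (fun u v => s u v : V → V → Prop))
      (fun s t h => Setoid.ext fun a b => iff_of_eq (congrFun (congrFun h a) b))
  have := Fintype.ofFinite {s : Setoid V // ∀ u v, s u v → ¬ G.Adj u v}
  have hcard (s : Setoid V) := s.card_quotient_add_card_starEdges
  refine ⟨Finset.univ.image fun s : {s : Setoid V // ∀ u v, s u v → ¬ G.Adj u v} =>
    s.1.starEdges, ?_, ?_, ?_, ?_⟩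
  · intro T hT
    obtain ⟨s, -, rfl⟩ := Finset.mem_image.1 hT
    rw [Finset.mem_powerset]
    intro e he
    induction e with
    | h u v =>
      have hne : u ≠ v := by
        rintro rfl
        simp [Setoid.starEdges] at he
      rw [mem_edgeFinset, mem_edgeSet, compl_adj]
      exact ⟨hne, s.2 u v (Setoid.rel_of_mk_mem_starEdges he)⟩
  · refine Finset.mem_image.2 ⟨⟨⊥, ?_⟩, Finset.mem_univ _, Setoid.starEdges_bot⟩
    rintro u v huv
    obtain rfl : u = v := huv
    exact G.irrefl
  · intro T hT
    obtain ⟨s, -, rfl⟩ := Finset.mem_image.1 hT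
    have := hcard s.1
    omega
  · rw [Finset.sum_image fun s _ t _ h => Subtype.ext (Setoid.starEdges_injective h),
      chromaticPolynomial_eq_finsum, finsum_eq_sum_of_fintype, map_sum]
    refine Finset.sum_congr rfl fun s _ => ?_
    rw [← hcard s.1, Nat.add_sub_cancel, aeval_def, eval₂_eq_eval_map, descPochhammer_map,
      descPochhammer_eval_eq_prod_range]

end SimpleGraph

/-! ### Estimates for sums of falling factorials -/

theorem norm_sq_le_two_mul_norm_add_sq {w : ℂ} {a y : ℝ} (ha : 0 ≤ a) (hay : 2 * a ^ 2 ≤ y ^ 2)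
    (hy : 0 ≤ y) (hw : y ≤ |w.im| ∨ y ≤ w.re) : ‖w‖ ^ 2 ≤ 2 * ‖w + a‖ ^ 2 := by
  simp only [← Complex.normSq_eq_norm_sq, Complex.normSq_apply, Complex.add_re, Complex.add_im,
    Complex.ofReal_re, Complex.ofReal_im, add_zero]
  rcases hw with hw | hw
  · have : y ^ 2 ≤ w.im ^ 2 := by
      rw [← sq_abs w.im]
      gcongr
    nlinarith [sq_nonneg (w.re + 2 * a)]
  · have := mul_nonneg (hy.trans hw) ha
    nlinarith [sq_nonneg w.re, sq_nonneg w.im, sq_nonneg a]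

theorem norm_prod_range_sub_mul_pow_le {z : ℂ} {y : ℝ} {n : ℕ} (hy : 0 ≤ y)
    (h : ∀ j < n, y ≤ ‖z - j‖) {i : ℕ} (hi : i ≤ n) :
    ‖∏ j ∈ Finset.range (n - i), (z - j)‖ * y ^ i ≤ ‖∏ j ∈ Finset.range n, (z - j)‖ := by
  obtain ⟨d, rfl⟩ := Nat.exists_eq_add_of_le' hi
  rw [Nat.add_sub_cancel, Finset.prod_range_add, norm_mul]
  gcongr
  rw [norm_prod]
  calc y ^ i = ∏ _j ∈ Finset.range i, y := by simp
    _ ≤ _ := by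
      refine Finset.prod_le_prod (fun _ _ => hy) fun j hj => h _ ?_
      have := Finset.mem_range.1 hj
      omega

/-- The sum of `x ^ #T` over all `T ⊆ E` with at least two elements is at most `(#E * x) ^ 2`. -/
theorem Finset.sum_powerset_pow_card_le {α : Type*} (E : Finset α) {x : ℝ}
    (hx : 0 ≤ x) (hE : E.card * x ≤ 1) :
    ∑ T ∈ E.powerset with 2 ≤ T.card, x ^ T.card ≤ (E.card * x) ^ 2 := by
  classical
  have hall : ∑ T ∈ E.powerset, x ^ T.card = (1 + x) ^ E.card := by
    have := Finset.sum_pow_mul_eq_add_pow x 1 E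
    simpa [add_comm] using this
  have hsmall : ∑ T ∈ E.powerset with ¬ 2 ≤ T.card, x ^ T.card = 1 + E.card * x := by
    have : E.powerset.filter (fun T => ¬ 2 ≤ T.card) = E.powersetCard 0 ∪ E.powersetCard 1 := by
      ext T
      simp only [mem_filter, mem_powerset, mem_union, mem_powersetCard, ← and_or_left]
      refine and_congr_right fun _ => ?_
      omega
    rw [this, sum_union (Finset.pairwise_disjoint_powersetCard E (by decide : (0 : ℕ) ≠ 1)),
      sum_congr rfl (s₁ := powersetCard 1 E) (g := fun _ => x) fun T hT => by
        rw [(mem_powersetCard.1 hT).2, pow_one]]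
    simp
  have hsplit := Finset.sum_filter_add_sum_filter_not E.powerset (fun T => 2 ≤ T.card)
    fun T => x ^ T.card
  have hexp : (1 + x) ^ E.card ≤ Real.exp (E.card * x) := by
    rw [Real.exp_nat_mul]
    gcongr
    linarith [Real.add_one_le_exp x]
  have hquad := (abs_le.1 (Real.abs_exp_sub_one_sub_id_le
    (abs_le.2 ⟨by linarith [mul_nonneg E.card.cast_nonneg hx], hE⟩))).2
  linarith

/-- A sum of falling factorials of `z` indexed by a family of subsets of `E` that contains `∅` does
not vanish if `z` is far from `0, 1, …, n - 1`, compared with `#E`. -/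
theorem sum_prod_range_sub_ne_zero {α : Type*} {E : Finset α} {A : Finset (Finset α)}
    (hA : A ⊆ E.powerset) (h0 : ∅ ∈ A) {n : ℕ} (hn : ∀ T ∈ A, T.card ≤ n) {z : ℂ} {y : ℝ}
    (hy : √2 * E.card < y) (hz : ∀ j < n, y ≤ |(z - j).im| ∨ y ≤ (z - j).re) :
    ∑ T ∈ A, ∏ j ∈ Finset.range (n - T.card), (z - j) ≠ 0 := by
  classical
  intro hsum
  have hy0 : 0 < y := lt_of_le_of_lt (by positivity) hy
  have hs2 : √2 ^ 2 = 2 := Real.sq_sqrt (by norm_num)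
  have hky : 2 * (E.card : ℝ) ^ 2 < y ^ 2 := by
    rw [← hs2, ← mul_pow]
    gcongr
  have hnorm : ∀ j < n, y ≤ ‖z - j‖ := fun j hj => (hz j hj).elim
    (fun h => h.trans (Complex.abs_im_le_norm _)) fun h => h.trans (Complex.re_le_norm _)
  set D : ℕ → ℂ := fun i => ∏ j ∈ Finset.range i, (z - j) with hD
  have hDn : 0 < ‖D n‖ := by
    rw [norm_pos_iff, hD, Finset.prod_ne_zero_iff]
    intro j hj
    exact norm_pos_iff.1 (hy0.trans_le (hnorm j (Finset.mem_range.1 hj)))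
  set a : ℕ := (A.filter fun T => T.card = 1).card with ha
  have hak : a ≤ E.card := by
    rw [← Nat.choose_one_right E.card, ← Finset.card_powersetCard]
    refine Finset.card_le_card fun T hT => ?_
    rw [Finset.mem_filter] at hT
    exact Finset.mem_powersetCard.2 ⟨Finset.mem_powerset.1 (hA hT.1), hT.2⟩
  have hsmall : ∑ T ∈ A with ¬ 2 ≤ T.card, D (n - T.card) = D n + a * D (n - 1) := by
    have : A.filter (fun T => ¬ 2 ≤ T.card) = insert ∅ (A.filter fun T => T.card = 1) := by
      ext T
      simp only [Finset.mem_filter, Finset.mem_insert]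
      constructor
      · rintro ⟨hT, h⟩
        rcases Nat.eq_zero_or_pos T.card with h' | h'
        · exact .inl (Finset.card_eq_zero.1 h')
        · exact .inr ⟨hT, by omega⟩
      · rintro (rfl | ⟨hT, h⟩)
        · exact ⟨h0, by simp⟩
        · exact ⟨hT, by omega⟩
    rw [this, Finset.sum_insert (by simp),
      Finset.sum_congr rfl (g := fun _ => D (n - 1)) fun T hT => by
        rw [(Finset.mem_filter.1 hT).2]]
    simp [ha]
  have hlow : ‖D n‖ ^ 2 ≤ 2 * ‖D n + a * D (n - 1)‖ ^ 2 := by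
    rcases Nat.eq_zero_or_pos a with h | h
    · rw [h, Nat.cast_zero, zero_mul, add_zero]
      linarith [sq_nonneg ‖D n‖]
    · obtain ⟨T, hT⟩ := Finset.card_pos.1 h
      rw [Finset.mem_filter] at hT
      have hn1 : 1 ≤ n := hT.2 ▸ hn T hT.1
      obtain ⟨l, rfl⟩ := Nat.exists_eq_add_of_le' hn1
      have hstep : D (l + 1) = D l * (z - l) := Finset.prod_range_succ _ _
      have hak' : (a : ℝ) ^ 2 ≤ (E.card : ℝ) ^ 2 := by gcongr
      have hw := norm_sq_le_two_mul_norm_add_sq (w := z - l) (a := a) (Nat.cast_nonneg a)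
        (by linarith) hy0.le (hz l (by omega))
      rw [Complex.ofReal_natCast] at hw
      rw [Nat.add_sub_cancel, hstep,
        show D l * (z - l) + a * D l = D l * (z - l + a) by ring, norm_mul, norm_mul]
      nlinarith [mul_le_mul_of_nonneg_left hw (sq_nonneg ‖D l‖)]
  have hbig : ‖∑ T ∈ A with 2 ≤ T.card, D (n - T.card)‖ ≤ ‖D n‖ * (E.card * y⁻¹) ^ 2 := by
    calc ‖∑ T ∈ A with 2 ≤ T.card, D (n - T.card)‖
        ≤ ∑ T ∈ A with 2 ≤ T.card, ‖D n‖ * y⁻¹ ^ T.card := by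
          refine norm_sum_le_of_le _ fun T hT => ?_
          rw [inv_pow, ← div_eq_mul_inv, le_div_iff₀ (by positivity)]
          exact norm_prod_range_sub_mul_pow_le hy0.le hnorm (hn T (Finset.mem_filter.1 hT).1)
      _ ≤ ∑ T ∈ E.powerset with 2 ≤ T.card, ‖D n‖ * y⁻¹ ^ T.card :=
          Finset.sum_le_sum_of_subset_of_nonneg (Finset.filter_subset_filter _ hA)
            fun T _ _ => by positivity
      _ ≤ ‖D n‖ * (E.card * y⁻¹) ^ 2 := by
          rw [← Finset.mul_sum]
          refine mul_le_mul_of_nonneg_left (E.sum_powerset_pow_card_le (by positivity) ?_)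
            (norm_nonneg _)
          rw [← div_eq_mul_inv, div_le_one hy0]
          exact le_of_sq_le_sq (by nlinarith [sq_nonneg (E.card : ℝ)]) hy0.le
  have ht : (E.card * y⁻¹) ^ 2 < 1 / 2 := by
    rw [← div_eq_mul_inv, div_pow, div_lt_iff₀ (by positivity)]
    linarith
  have hsplit := Finset.sum_filter_add_sum_filter_not A (fun T => 2 ≤ T.card)
    fun T => D (n - T.card)
  rw [hsmall, hsum] at hsplit
  have heq : ‖D n + a * D (n - 1)‖ = ‖∑ T ∈ A with 2 ≤ T.card, D (n - T.card)‖ := by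
    rw [eq_neg_of_add_eq_zero_right hsplit, norm_neg]
  have hlt : ‖D n + a * D (n - 1)‖ ≤ ‖D n‖ * (1 / 2) :=
    heq.trans_le (hbig.trans (mul_le_mul_of_nonneg_left ht.le (norm_nonneg _)))
  nlinarith [pow_le_pow_left₀ (norm_nonneg _) hlt 2, pow_pos hDn 2]

/-! ### Bounds for chromatic roots -/

theorem mainTheorem4 {V : Type*} [Fintype V] (G : SimpleGraph V) [Fintype G.edgeSet]
    (n m : ℕ) (hn : Fintype.card V = n) (hm : G.edgeFinset.card = m)
    (z : ℂ) (hz : aeval z G.chromaticPolynomial = 0) :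
    |z.im| ≤ √2 * ((n.choose 2 : ℝ) - (m : ℝ)) ∧
      z.re ≤ (n : ℝ) - 1 + √2 * ((n.choose 2 : ℝ) - (m : ℝ)) := by
  classical
  obtain ⟨A, hA, h0, hcard, hsum⟩ := G.exists_aeval_chromaticPolynomial_eq_sum z
  rw [hn] at hcard hsum
  rw [hz] at hsum
  have hk : ((n.choose 2 : ℝ) - (m : ℝ)) = Gᶜ.edgeFinset.card := by
    have hunion : m + Gᶜ.edgeFinset.card = n.choose 2 := by
      rw [← hm, ← hn, ← SimpleGraph.card_edgeFinset_top_eq_card_choose_two,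
        ← Finset.card_union_of_disjoint
          (SimpleGraph.disjoint_edgeFinset.2 disjoint_compl_right),
        ← SimpleGraph.edgeFinset_sup]
      congr 1
      ext e
      simp only [SimpleGraph.mem_edgeFinset, sup_compl_eq_top]
    rw [← hunion]
    push_cast
    ring
  rw [hk]
  constructor
  · by_contra! h
    refine sum_prod_range_sub_ne_zero hA h0 hcard h (fun j _ => .inl ?_) hsum.symm
    simp
  · by_contra! h
    refine sum_prod_range_sub_ne_zero hA h0 hcard (y := z.re - (n - 1)) (by linarith)
      (fun j hj => .inr ?_) hsum.symm
    have : (j : ℝ) + 1 ≤ n := by exact_mod_cast hj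
    simp only [Complex.sub_re, Complex.natCast_re]
    linarith
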